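/- **Proposition (the smooth worm has nontrivial Nebenhülle).** Let $\mu>\pi/2$ and let $\eta:\mathbf R\to\mathbf R$ be a $C^\infty$ function such that: $\eta\ge 0$, $\eta$ is even and convex; $\eta^{-1}(0)=[-\mu,\mu]$; there is $a>0$ with $\eta(x)>1$ whenever $|x|>a$; and $\eta'(x)\neq 0$ whenever $\eta(x)=1$. Let $$\mathcal W=\Big\{(z_1,z_2)\in\mathbf C^2:\ z_2\ne 0,\ \big|z_1-e^{i\log|z_2|^2}\big|^2<1-\eta(\log|z_2|^2)\Big\}$$ be the corresponding smooth worm domain. By a *pseudoconvex neighborhood* of $\overline{\mathcal W}$ we mean a set $U\supseteq\overline{\mathcal W}$ that is either an open set admitting a continuous plurisubharmonic exhaustion function, or a bounded domain with $C^\infty$ boundary that is Levi pseudoconvex. Then: 1. $\mathcal W$ has nontrivial Nebenhülle, i.e. there is no sequence of smoothly bounded, Levi pseudoconvex domains $W_1\supset\supset W_2\supset\supset\cdots\supset\supset\overline{\mathcal W}$ with $\bigcap_j W_j=\overline{\mathcal W}$. 2. The pseudoconvex neighborhoods of $\overline{\mathcal W}$ do not form a neighborhood basis of $\overline{\mathcal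 W}$: some open $V\supseteq\overline{\mathcal W}$ contains no pseudoconvex neighborhood of $\overline{\mathcal W}$. 3. For every $\tau$ with $\pi/2<\tau\le\min(\mu,\pi)$, the set $$\widehat K_\tau=\big\{(z_1,z_2)\in\mathbf C^2:\ z_2\neq 0,\ \big|\log|z_2|^2\big|\le\tau,\ |z_1-e^{i\tau}|\le 1,\ |z_1-e^{-i\tau}|\le 1\big\}$$ is not contained in $\overline{\mathcal W}$, but it is contained in every pseudoconvex neighborhood of $\overline{\mathcal W}$. In particular, if $\mu\ge\pi$, every pseudoconvex neighborhood of $\overline{\mathcal W}$ contains $\{(z_1,z_2):\ -\pi\le\log|z_2|^2\le\pi,\ |z_1+1|\le 1\}$. -/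

import Mathlib

open scoped ContDiff

/-- The admissible profiles `η` of the smooth worm with parameter `μ`: smooth, nonnegative, even,
convex, vanishing exactly on `[-μ, μ]`, larger than `1` far out, and with nonzero derivative
wherever `η = 1`. -/
structure IsWormProfile (μ : ℝ) (η : ℝ → ℝ) : Prop where
  smooth : ContDiff ℝ ∞ η
  nonneg : ∀ x, 0 ≤ η x
  even : ∀ x, η (-x) = η x
  convex : ConvexOn ℝ Set.univ η
  zero_set : η ⁻¹' {0} = Set.Icc (-μ) μ
  large : ∃ a : ℝ, 0 < a ∧ ∀ x, a < |x| → 1 < η x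
  deriv_ne_zero : ∀ x, η x = 1 → deriv η x ≠ 0

/-- The winding angle `log |z₂|²`. -/
noncomputable def wormAngle (w : ℂ) : ℝ := Real.log (‖w‖ ^ 2)

/-- The worm domain
`{(z₁, z₂) : |z₁ - exp (i log |z₂|²)|² < 1 - η (log |z₂|²)}` in `ℂ²`.
The expression `log |z₂|²` makes sense only for `z₂ ≠ 0`. -/
def wormDomain (η : ℝ → ℝ) : Set (ℂ × ℂ) :=
  {z | z.2 ≠ 0 ∧
    ‖z.1 - Complex.exp (Complex.I * (wormAngle z.2 : ℂ))‖ ^ 2 < 1 - η (wormAngle z.2)}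

/-- The filled Hartogs figure of height `τ`: all annuli `{z₁} × {|log |z₂|²| ≤ τ}` for `z₁` in
the intersection of the two closed unit discs centred at `exp (iτ)` and `exp (-iτ)`. For `τ = π`
both discs are `|z₁ + 1| ≤ 1`. -/
def filledHartogsFigure (τ : ℝ) : Set (ℂ × ℂ) :=
  {z | z.2 ≠ 0 ∧ |wormAngle z.2| ≤ τ ∧
    ‖z.1 - Complex.exp (Complex.I * (τ : ℂ))‖ ≤ 1 ∧
    ‖z.1 - Complex.exp (-(Complex.I * (τ : ℂ)))‖ ≤ 1}

/-- A continuous plurisubharmonic function on an open set `U` of `ℂ²`: the sub-mean value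
inequality holds on every closed affine complex disc contained in `U`. -/
def IsContinuousPSHOn (φ : ℂ × ℂ → ℝ) (U : Set (ℂ × ℂ)) : Prop :=
  ContinuousOn φ U ∧
    ∀ z w : ℂ × ℂ, (∀ ζ : ℂ, ‖ζ‖ ≤ 1 → z + ζ • w ∈ U) →
      φ z ≤ Real.circleAverage (fun ζ : ℂ => φ (z + ζ • w)) 0 1

/-- Pseudoconvexity of an open set of `ℂ²`, without boundary regularity: there is a continuous
plurisubharmonic exhaustion function. -/
def IsPseudoconvex (U : Set (ℂ × ℂ)) : Prop :=
  IsOpen U ∧ ∃ φ : ℂ × ℂ → ℝ, IsContinuousPSHOn φ U ∧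
    ∀ c : ℝ, IsCompact {z ∈ U | φ z ≤ c}

/-- `r` is a smooth defining function of `Ω`. -/
structure IsSmoothDefiningFunction (r : ℂ × ℂ → ℝ) (Ω : Set (ℂ × ℂ)) : Prop where
  smooth : ContDiff ℝ ∞ r
  eq_neg : Ω = {z | r z < 0}
  fderiv_ne_zero : ∀ p, r p = 0 → fderiv ℝ r p ≠ 0

/-- The complex tangential condition `∑ⱼ (∂r/∂zⱼ)(p) wⱼ = 0`, written with the real derivative:
`2 ∑ⱼ (∂r/∂zⱼ)(p) wⱼ = dr(p) w - i dr(p) (i w)`. -/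
def IsComplexTangent (r : ℂ × ℂ → ℝ) (p w : ℂ × ℂ) : Prop :=
  fderiv ℝ r p w = 0 ∧ fderiv ℝ r p (Complex.I • w) = 0

/-- The Levi form `∑ⱼₖ (∂²r/∂zⱼ∂z̄ₖ)(p) wⱼ w̄ₖ`, that is, a quarter of the Laplacian at `ζ = 0` of
`ζ ↦ r (p + ζ w)`. -/
noncomputable def leviForm (r : ℂ × ℂ → ℝ) (p w : ℂ × ℂ) : ℝ :=
  (fderiv ℝ (fderiv ℝ r) p w w +
    fderiv ℝ (fderiv ℝ r) p (Complex.I • w) (Complex.I • w)) / 4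

/-- A smoothly bounded (Levi) pseudoconvex domain in `ℂ²`. -/
def IsSmoothlyBoundedPseudoconvexDomain (Ω : Set (ℂ × ℂ)) : Prop :=
  IsConnected Ω ∧ Bornology.IsBounded Ω ∧
    ∃ r : ℂ × ℂ → ℝ, IsSmoothDefiningFunction r Ω ∧
      ∀ p ∈ frontier Ω, ∀ w, IsComplexTangent r p w → 0 ≤ leviForm r p w

/-- `Ω` has a Stein neighbourhood basis: there are smoothly bounded pseudoconvex domains
`W₀ ⊃⊃ W₁ ⊃⊃ ⋯ ⊃⊃ closure Ω` with intersection `closure Ω`. -/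
def HasSteinNeighborhoodBasis (Ω : Set (ℂ × ℂ)) : Prop :=
  ∃ W : ℕ → Set (ℂ × ℂ),
    (∀ j, IsSmoothlyBoundedPseudoconvexDomain (W j)) ∧
    (∀ j, closure (W (j + 1)) ⊆ W j) ∧
    (∀ j, closure Ω ⊆ W j) ∧
    ⋂ j, W j = closure Ω

/-- Nontrivial Nebenhülle: there is no Stein neighbourhood basis. -/
def HasNontrivialNebenhulle (Ω : Set (ℂ × ℂ)) : Prop :=
  ¬ HasSteinNeighborhoodBasis Ω

open Set Filter Topology

/-! The argument is a continuity principle for vertical annuli. With `A` the annulus of height `τ ≤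
μ`, the slice `{0} × A` lies in the closed worm, since `0` is at distance 1 from every `exp (iθ)`.
The two boundary circles of `A` have angle `±τ`, where the fibre of the closed worm contains the
closed unit disc about `exp (±iτ)`. If `a` lies in both discs, so does the segment from `0` to `a`,
by convexity; sliding the annulus along it keeps its boundary in the closed worm, and
pseudoconvexity of `U` forces the whole annulus to stay in `U`.

The form of pseudoconvexity used is `HasVerticalHulls`. For a plurisubharmonic exhaustion it is the
maximum principle. For a Levi pseudoconvex domain no exhaustion is constructed: the maximum
principle is proved directly for `r * exp (-C |z₂|²)` near the boundary, from a lower bound of the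
Levi form by `|r|` and the holomorphic derivative.

Finally `(2 cos τ, 1)` lies in the figure but not in the closed worm when `π/2 < τ ≤ π`, which gives
all three assertions. -/

/-- Compact families of circles in `U` have compact hulls in `U`, for the family of all vertical
translates of a planar set `A`. -/
def HasVerticalHulls (U : Set (ℂ × ℂ)) (A : Set ℂ) : Prop :=
  ∀ K ⊆ U, IsCompact K → ∃ K' ⊆ U, IsCompact K' ∧
    ∀ a : ℂ, (∀ b ∈ A, (a, b) ∈ U) → (∀ b ∈ frontier A, (a, b) ∈ K) → ∀ b ∈ A, (a, b) ∈ K'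

/-- The continuity principle along the segment from `(0, ·)` to `(a, ·)`. -/
theorem HasVerticalHulls.mem_of_segment {U : Set (ℂ × ℂ)} {A : Set ℂ} (h : HasVerticalHulls U A)
    (hU : IsOpen U) (hA : IsCompact A) (h0 : ∀ b ∈ A, ((0 : ℂ), b) ∈ U) {a : ℂ}
    (ha : ∀ t ∈ Icc (0 : ℝ) 1, ∀ b ∈ frontier A, ((t : ℂ) * a, b) ∈ U) {b : ℂ} (hb : b ∈ A) :
    (a, b) ∈ U := by
  let F : unitInterval × ℂ → ℂ × ℂ := fun p => (((p.1 : ℝ) : ℂ) * a, p.2)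
  have hF : Continuous F := by fun_prop
  have hfr : IsCompact (frontier A) :=
    hA.of_isClosed_subset isClosed_frontier hA.isClosed.frontier_subset
  obtain ⟨K', hK'U, hK', hull⟩ := h (F '' (univ ×ˢ frontier A))
    (by rintro _ ⟨⟨t, c⟩, ⟨-, hc⟩, rfl⟩; exact ha t t.2 c hc)
    ((isCompact_univ.prod hfr).image hF)
  have key : ∀ t : unitInterval, (∀ c ∈ A, F (t, c) ∈ U) ↔ ∀ c ∈ A, F (t, c) ∈ K' := fun t =>
    ⟨fun ht => hull (((t : ℝ) : ℂ) * a) ht fun c hc => ⟨(t, c), ⟨mem_univ t, hc⟩, rfl⟩, fun ht c hc =>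
      hK'U (ht c hc)⟩
  -- Connectedness of the interval: the condition is open by compactness of `A`, and closed because
  -- membership in `U` is equivalent to membership in the compact `K'`.
  have hclopen : IsClopen {t : unitInterval | ∀ c ∈ A, F (t, c) ∈ U} := by
    constructor
    · simp only [key, ofPred_forall]
      exact isClosed_biInter fun c _ => hK'.isClosed.preimage (hF.comp (by fun_prop))
    · rw [isOpen_iff_mem_nhds]
      intro t ht
      refine hA.eventually_forall_of_forall_eventually fun c hc => ?_
      exact (hU.preimage hF).mem_nhds (ht c hc)
  have huniv := hclopen.eq_univ ⟨0, by simpa [F] using h0⟩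
  have h1 : (1 : unitInterval) ∈ {t : unitInterval | ∀ c ∈ A, F (t, c) ∈ U} := huniv ▸ mem_univ _
  simpa [F] using h1 b hb

/-! ### Maximum principle for plurisubharmonic exhaustions -/

theorem circleAverage_lt_of_le_of_lt {f : ℂ → ℝ} {M : ℝ} (hf : ContinuousOn f (Metric.sphere 0 1))
    (hle : ∀ ζ ∈ Metric.sphere (0 : ℂ) 1, f ζ ≤ M) (hlt : f 1 < M) :
    Real.circleAverage f 0 1 < M := by
  have hs : ∀ θ : ℝ, circleMap 0 1 θ ∈ Metric.sphere (0 : ℂ) 1 :=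
    fun θ => circleMap_mem_sphere _ zero_le_one _
  have hi : ∫ θ in (0 : ℝ)..2 * Real.pi, f (circleMap 0 1 θ) <
      ∫ _ in (0 : ℝ)..2 * Real.pi, M := by
    refine intervalIntegral.integral_lt_integral_of_continuousOn_of_le_of_exists_lt
      Real.two_pi_pos ?_ continuousOn_const (fun θ _ => hle _ (hs θ))
      ⟨0, ⟨le_rfl, Real.two_pi_pos.le⟩, by simpa [circleMap] using hlt⟩
    exact (hf.comp_continuous (continuous_circleMap 0 1) hs).continuousOn
  rw [Real.circleAverage_def, smul_eq_mul, inv_mul_lt_iff₀ Real.two_pi_pos]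
  simpa using hi

/-- The maximum principle for continuous plurisubharmonic functions on vertical planar sets. -/
theorem IsContinuousPSHOn.le_of_le_on_frontier {φ : ℂ × ℂ → ℝ} {U : Set (ℂ × ℂ)}
    (hφ : IsContinuousPSHOn φ U) {A : Set ℂ} (hA : IsCompact A) {a : ℂ}
    (hAU : ∀ b ∈ A, (a, b) ∈ U) {c : ℝ} (hc : ∀ b ∈ frontier A, φ (a, b) ≤ c) {b : ℂ}
    (hb : b ∈ A) : φ (a, b) ≤ c := by
  have hcont : ContinuousOn (fun b => φ (a, b)) A :=
    hφ.1.comp (by fun_prop) hAU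
  obtain ⟨p, hpA, hp⟩ := hA.exists_isMaxOn ⟨b, hb⟩ hcont
  refine (hp hb).trans ?_
  by_contra! hlt
  let S := A ∩ (fun b => φ (a, b)) ⁻¹' {φ (a, p)}
  have hS : IsCompact S := by
    refine hA.of_isClosed_subset ?_ inter_subset_left
    exact hcont.preimage_isClosed_of_isClosed hA.isClosed isClosed_singleton
  -- Among the maximum points take one with largest real part: on a small circle about `q` the
  -- rightmost point `q + δ` is then strictly below the maximum, contradicting the sub-mean value
  -- inequality.
  obtain ⟨q, ⟨hqA, hq⟩, hqmax⟩ := hS.exists_isMaxOn ⟨p, hpA, rfl⟩ Complex.continuous_re.continuousOn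
  replace hq : φ (a, q) = φ (a, p) := hq
  have hqi : q ∈ interior A := by
    by_contra hqi
    have := hc q ⟨subset_closure hqA, hqi⟩
    linarith
  obtain ⟨δ, hδ, hball⟩ := Metric.nhds_basis_closedBall.mem_iff.1 (mem_interior_iff_mem_nhds.1 hqi)
  have hdisc : ∀ ζ : ℂ, ‖ζ‖ ≤ 1 → q + ζ * δ ∈ A := fun ζ hζ => hball (by
    simpa [abs_of_pos hδ] using mul_le_of_le_one_left hδ.le hζ)
  have heq : ∀ ζ : ℂ, (a, q) + ζ • ((0 : ℂ), (δ : ℂ)) = (a, q + ζ * δ) := fun ζ => by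
    simp
  have hmean := hφ.2 (a, q) (0, (δ : ℂ)) fun ζ hζ => by
    rw [heq]; exact hAU _ (hdisc ζ hζ)
  simp only [heq] at hmean
  refine absurd hmean (not_le.2 ?_)
  refine circleAverage_lt_of_le_of_lt (hcont.comp (by fun_prop) fun ζ hζ => hdisc ζ ?_)
    (fun ζ hζ => ?_) ?_
  · simpa using (mem_sphere_zero_iff_norm.1 hζ).le
  · rw [hq]
    exact hp (hdisc ζ (mem_sphere_zero_iff_norm.1 hζ).le)
  · have h1 := hdisc 1 (by simp)
    rw [hq]
    refine lt_of_le_of_ne (hp h1) fun h => ?_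
    have := hqmax (show q + 1 * δ ∈ S from ⟨h1, h⟩)
    simp at this
    linarith

theorem IsPseudoconvex.hasVerticalHulls {U : Set (ℂ × ℂ)} (hU : IsPseudoconvex U) {A : Set ℂ}
    (hA : IsCompact A) : HasVerticalHulls U A := by
  obtain ⟨-, φ, hφ, hexh⟩ := hU
  intro K hKU hK
  obtain ⟨c, hc⟩ := (hK.image_of_continuousOn (hφ.1.mono hKU)).bddAbove
  refine ⟨_, fun z hz => hz.1, hexh c, fun a haU haK b hb => ⟨haU b hb, ?_⟩⟩
  exact hφ.le_of_le_on_frontier hA haU (fun b hb => hc ⟨_, haK b hb, rfl⟩) hb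

theorem IsSmoothlyBoundedPseudoconvexDomain.isOpen {U : Set (ℂ × ℂ)}
    (hU : IsSmoothlyBoundedPseudoconvexDomain U) : IsOpen U := by
  obtain ⟨-, -, r, hr, -⟩ := hU
  rw [hr.eq_neg]
  exact isOpen_lt hr.smooth.continuous continuous_const

/-! ### Geometry of the worm and of the Hartogs figure -/

/-- The closed annulus `|log |w|²| ≤ τ`. -/
def logAnnulus (τ : ℝ) : Set ℂ := {w | w ≠ 0 ∧ |wormAngle w| ≤ τ}

theorem continuousAt_wormAngle {w : ℂ} (hw : w ≠ 0) : ContinuousAt wormAngle w :=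
  ContinuousAt.log (by fun_prop) (by simpa using hw)

theorem logAnnulus_eq (τ : ℝ) :
    logAnnulus τ = {w | Real.exp (-τ) ≤ ‖w‖ ^ 2 ∧ ‖w‖ ^ 2 ≤ Real.exp τ} := by
  ext w
  by_cases hw : w = 0
  · simp [logAnnulus, hw, Real.exp_pos]
  · have h : 0 < ‖w‖ ^ 2 := by positivity
    simp [logAnnulus, hw, wormAngle, abs_le, Real.le_log_iff_exp_le h, Real.log_le_iff_le_exp h,
      -Real.log_pow]

theorem isCompact_logAnnulus (τ : ℝ) : IsCompact (logAnnulus τ) := by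
  rw [logAnnulus_eq]
  refine Metric.isCompact_of_isClosed_isBounded ?_ ?_
  · exact (isClosed_le (continuous_const (y := Real.exp (-τ))) (continuous_norm.pow 2)).inter
      (isClosed_le (continuous_norm.pow 2) (continuous_const (y := Real.exp τ)))
  · refine (Metric.isBounded_closedBall (x := (0 : ℂ)) (r := √(Real.exp τ))).subset ?_
    intro w hw
    simpa using Real.le_sqrt_of_sq_le hw.2

theorem wormAngle_of_mem_frontier {τ : ℝ} {w : ℂ} (hw : w ∈ frontier (logAnnulus τ)) :
    w ≠ 0 ∧ |wormAngle w| = τ := by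
  have hmem := (isCompact_logAnnulus τ).isClosed.frontier_subset hw
  refine ⟨hmem.1, le_antisymm hmem.2 (not_lt.1 fun hlt => hw.2 ?_)⟩
  rw [mem_interior_iff_mem_nhds]
  filter_upwards [(continuousAt_wormAngle hmem.1).abs.eventually_lt_const hlt,
    isOpen_ne.mem_nhds hmem.1] with v hv hv0 using ⟨hv0, hv.le⟩

theorem mem_closure_wormDomain {μ : ℝ} {η : ℝ → ℝ} (hη : IsWormProfile μ η) {z : ℂ × ℂ}
    (h2 : z.2 ≠ 0) (hangle : |wormAngle z.2| ≤ μ)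
    (h1 : ‖z.1 - Complex.exp (Complex.I * (wormAngle z.2 : ℂ))‖ ≤ 1) :
    z ∈ closure (wormDomain η) := by
  have h0 : η (wormAngle z.2) = 0 := by
    have : wormAngle z.2 ∈ η ⁻¹' {0} := by rw [hη.zero_set]; exact abs_le.1 hangle
    exact this
  have hcl : z.1 ∈ closure (Metric.ball (Complex.exp (Complex.I * (wormAngle z.2 : ℂ))) 1) := by
    rw [closure_ball _ one_ne_zero]
    simpa [dist_eq_norm] using h1
  have hmap : MapsTo (fun a : ℂ => (a, z.2))
      (Metric.ball (Complex.exp (Complex.I * (wormAngle z.2 : ℂ))) 1) (wormDomain η) := by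
    intro a ha
    refine ⟨h2, ?_⟩
    rw [Metric.mem_ball, dist_eq_norm] at ha
    simpa [h0] using ha
  exact hmap.closure (by fun_prop) hcl

theorem norm_exp_I_mul (θ : ℝ) : ‖Complex.exp (Complex.I * (θ : ℂ))‖ = 1 := by
  rw [mul_comm]; exact Complex.norm_exp_ofReal_mul_I θ

theorem norm_exp_neg_I_mul (θ : ℝ) : ‖Complex.exp (-(Complex.I * (θ : ℂ)))‖ = 1 := by
  simpa using norm_exp_I_mul (-θ)

theorem norm_ofReal_mul_sub_le_one {t : ℝ} (ht : t ∈ Icc (0 : ℝ) 1) {a c : ℂ} (hc : ‖c‖ = 1)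
    (ha : ‖a - c‖ ≤ 1) : ‖(t : ℂ) * a - c‖ ≤ 1 := by
  have h := convex_closedBall c 1 (show (0 : ℂ) ∈ _ by simp [dist_eq_norm, hc])
    (show a ∈ _ by simpa [dist_eq_norm] using ha) (sub_nonneg.2 ht.2) ht.1 (by ring)
  simpa [dist_eq_norm] using h

/-- The continuity principle applied to annuli sliding from `0` to `a`; only the two boundary
circles, of angle `±τ`, have to remain in the closed worm. -/
theorem filledHartogsFigure_subset {μ τ : ℝ} {η : ℝ → ℝ} (hη : IsWormProfile μ η) (hτ : τ ≤ μ)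
    {U : Set (ℂ × ℂ)} (hU : IsOpen U) (hull : HasVerticalHulls U (logAnnulus τ))
    (hWU : closure (wormDomain η) ⊆ U) : filledHartogsFigure τ ⊆ U := by
  rintro ⟨a, b⟩ ⟨hb0, hb, hp, hm⟩
  refine hull.mem_of_segment hU (isCompact_logAnnulus τ) (fun w hw => hWU ?_)
    (fun t ht w hw => hWU ?_) ⟨hb0, hb⟩
  · refine mem_closure_wormDomain hη hw.1 (hw.2.trans hτ) ?_
    simp
  · obtain ⟨hw0, hwτ⟩ := wormAngle_of_mem_frontier hw
    refine mem_closure_wormDomain hη hw0 (hwτ.trans_le hτ) ?_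
    refine norm_ofReal_mul_sub_le_one ht (norm_exp_I_mul _) ?_
    have hτ0 : 0 ≤ τ := hwτ ▸ abs_nonneg _
    rcases (abs_eq hτ0).1 hwτ with h | h
    · simpa [h] using hp
    · simpa [h] using hm

theorem wormAngle_one : wormAngle 1 = 0 := by simp [wormAngle]

theorem two_cos_mem_filledHartogsFigure {τ : ℝ} (hτ : 0 ≤ τ) :
    (((2 * Real.cos τ : ℝ) : ℂ), (1 : ℂ)) ∈ filledHartogsFigure τ := by
  have h : ((2 * Real.cos τ : ℝ) : ℂ) =
      Complex.exp (Complex.I * (τ : ℂ)) + Complex.exp (-(Complex.I * (τ : ℂ))) := by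
    rw [Complex.ofReal_mul, Complex.ofReal_cos, Complex.ofReal_ofNat, Complex.two_cos]
    ring_nf
  refine ⟨one_ne_zero, by simpa [wormAngle_one] using hτ, ?_, ?_⟩
  · simp only [h, add_sub_cancel_left, norm_exp_neg_I_mul, le_refl]
  · simp only [h, add_sub_cancel_right, norm_exp_I_mul, le_refl]

/-- At `z₂ = 1` the angle is `0`, so by continuity points of the closure satisfy `|z₁ - 1| ≤ 1`,
which excludes the negative number `2 cos τ`. -/
theorem two_cos_notMem_closure_wormDomain {μ τ : ℝ} {η : ℝ → ℝ} (hη : IsWormProfile μ η)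
    (h1 : Real.pi / 2 < τ) (h2 : τ ≤ Real.pi) :
    (((2 * Real.cos τ : ℝ) : ℂ), (1 : ℂ)) ∉ closure (wormDomain η) := by
  intro hmem
  have hcos : Real.cos τ < 0 := Real.cos_neg_of_pi_div_two_lt_of_lt h1 (by linarith [Real.pi_pos])
  have hang : ContinuousAt (fun z : ℂ × ℂ => wormAngle z.2)
      (((2 * Real.cos τ : ℝ) : ℂ), (1 : ℂ)) :=
    ContinuousAt.comp' (continuousAt_wormAngle one_ne_zero) continuousAt_snd
  have hF : ContinuousAt (fun z : ℂ × ℂ =>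
      ‖z.1 - Complex.exp (Complex.I * (wormAngle z.2 : ℂ))‖ ^ 2)
      (((2 * Real.cos τ : ℝ) : ℂ), (1 : ℂ)) := by
    refine ContinuousAt.pow (ContinuousAt.norm (continuousAt_fst.sub ?_)) 2
    exact (continuousAt_const.mul (Complex.continuous_ofReal.continuousAt.comp' hang)).cexp
  have hle := le_of_tendsto_of_frequently (b := (1 : ℝ)) hF
    ((mem_closure_iff_frequently.1 hmem).mono fun z hz => by
      linarith [hz.2, hη.nonneg (wormAngle z.2)])
  simp only [wormAngle_one, Complex.ofReal_zero, mul_zero, Complex.exp_zero] at hle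
  rw [← Complex.ofReal_one, ← Complex.ofReal_sub, Complex.norm_real, Real.norm_eq_abs,
    sq_abs] at hle
  nlinarith

/-! ### Optimality conditions on a line, and algebra of the Levi form -/

/-- A positive second derivative would make `x` a local minimum too, so `h` would be locally
constant and its second derivative zero. -/
theorem IsLocalMax.second_deriv_nonpos {h h' : ℝ → ℝ} {h'' x : ℝ} (hmax : IsLocalMax h x)
    (hd : ∀ s, HasDerivAt h (h' s) s) (hd' : HasDerivAt h' h'' x) : h'' ≤ 0 := by
  by_contra! hpos
  have hderiv : deriv h = h' := funext fun s => (hd s).deriv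
  have hmin : IsLocalMin h x := isLocalMin_of_deriv_deriv_pos
    (by rwa [hderiv, hd'.deriv]) hmax.deriv_eq_zero (hd x).continuousAt
  have hconst : h =ᶠ[𝓝 x] fun _ => h x := by
    filter_upwards [hmin, hmax] with s h1 h2 using le_antisymm h2 h1
  have h0 : h' =ᶠ[𝓝 x] fun _ => 0 := by
    have := hconst.deriv
    rw [hderiv] at this
    simpa using this
  have := hd'.unique ((hasDerivAt_const x (0 : ℝ)).congr_of_eventuallyEq h0)
  linarith

/-- First and second order conditions at a local maximum of `ρ(s) exp(-C(2xs + s²))`. -/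
theorem IsLocalMax.mul_gaussian {ρ ρ' : ℝ → ℝ} {ρ'' C x : ℝ}
    (hmax : IsLocalMax (fun s => ρ s * Real.exp (-(C * (2 * x * s + s ^ 2)))) 0)
    (hd : ∀ s, HasDerivAt ρ (ρ' s) s) (hd' : HasDerivAt ρ' ρ'' 0) :
    ρ' 0 = 2 * C * x * ρ 0 ∧ ρ'' ≤ ρ 0 * (2 * C + 4 * C ^ 2 * x ^ 2) := by
  have hq : ∀ s, HasDerivAt (fun s : ℝ => Real.exp (-(C * (2 * x * s + s ^ 2))))
      (Real.exp (-(C * (2 * x * s + s ^ 2))) * (-(C * (2 * x + 2 * s)))) s := fun s => by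
    have h := ((((hasDerivAt_id s).const_mul (2 * x)).add ((hasDerivAt_id s).pow 2)).const_mul
      C).neg.exp
    refine h.congr_deriv ?_
    simp
  have h1 : ∀ s, HasDerivAt (fun s => ρ s * Real.exp (-(C * (2 * x * s + s ^ 2))))
      (ρ' s * Real.exp (-(C * (2 * x * s + s ^ 2))) +
        ρ s * (Real.exp (-(C * (2 * x * s + s ^ 2))) * (-(C * (2 * x + 2 * s))))) s :=
    fun s => (hd s).mul (hq s)
  have hl : HasDerivAt (fun s : ℝ => -(C * (2 * x + 2 * s))) (-(C * 2)) 0 := by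
    have h := ((((hasDerivAt_id (0 : ℝ)).const_mul 2).const_add (2 * x)).const_mul C).neg
    refine h.congr_deriv ?_
    simp
  have h2 := (hd'.mul (hq 0)).add ((hd 0).mul ((hq 0).mul hl))
  have hfirst := hmax.hasDerivAt_eq_zero (h1 0)
  have hsecond := hmax.second_deriv_nonpos h1 h2
  simp at hfirst hsecond
  have e : ρ' 0 = 2 * C * x * ρ 0 := by linarith
  refine ⟨e, ?_⟩
  rw [e] at hsecond
  nlinarith

/-- Twice the holomorphic part of the differential, `w ↦ 2 ∑ⱼ (∂r/∂zⱼ)(p) wⱼ`. -/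
noncomputable def holoDeriv (r : ℂ × ℂ → ℝ) (p w : ℂ × ℂ) : ℂ :=
  (fderiv ℝ r p w : ℂ) - Complex.I * (fderiv ℝ r p (Complex.I • w) : ℂ)

theorem isComplexTangent_iff {r : ℂ × ℂ → ℝ} {p w : ℂ × ℂ} :
    IsComplexTangent r p w ↔ holoDeriv r p w = 0 := by
  simp [IsComplexTangent, holoDeriv, Complex.ext_iff]

theorem holoDeriv_sub_smul (r : ℂ × ℂ → ℝ) (p v w : ℂ × ℂ) (c : ℂ) :
    holoDeriv r p (v - c • w) = holoDeriv r p v - c * holoDeriv r p w := by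
  have hc : c • w = c.re • w + c.im • (Complex.I • w) := by
    conv_lhs => rw [← Complex.re_add_im c]
    rw [add_smul, mul_smul]; simp only [Complex.coe_smul]
  have hic : Complex.I • c • w = c.re • (Complex.I • w) - c.im • w := by
    rw [hc, smul_add, smul_comm _ c.re, smul_comm _ c.im, ← mul_smul, Complex.I_mul_I]
    simp [sub_eq_add_neg]
  simp only [holoDeriv, smul_sub, map_sub, hic]
  rw [hc]
  simp only [map_add, map_smul, smul_eq_mul]
  apply Complex.ext
  · simp
  · simp; ring

theorem abs_leviForm_sub_le (r : ℂ × ℂ → ℝ) (p v w : ℂ × ℂ) :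
    |leviForm r p v - leviForm r p w| ≤
      ‖fderiv ℝ (fderiv ℝ r) p‖ * (‖v - w‖ * (‖v‖ + ‖w‖)) := by
  set H := fderiv ℝ (fderiv ℝ r) p
  have key : ∀ x y : ℂ × ℂ, |H x x - H y y| ≤ ‖H‖ * (‖x - y‖ * (‖x‖ + ‖y‖)) := by
    intro x y
    -- A polarization that needs no symmetry of `H`.
    have e : H x x - H y y = H (x - y) x + H y (x - y) := by simp
    rw [e]
    have h1 := H.le_opNorm₂ (x - y) x
    have h2 := H.le_opNorm₂ y (x - y)
    rw [Real.norm_eq_abs] at h1 h2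
    refine (abs_add_le _ _).trans ((add_le_add h1 h2).trans (le_of_eq ?_))
    ring
  have h1 := key v w
  have h2 := key (Complex.I • v) (Complex.I • w)
  rw [← smul_sub] at h2
  simp only [norm_smul, Complex.norm_I, one_mul] at h2
  have h0 : 0 ≤ ‖H‖ * (‖v - w‖ * (‖v‖ + ‖w‖)) := by positivity
  unfold leviForm
  rw [abs_le] at *
  constructor <;> linarith

/-! ### Lower bounds for the Levi form near the boundary -/

section DefiningFunction

variable {r : ℂ × ℂ → ℝ} {U : Set (ℂ × ℂ)}

/-- A zero outside the closure would be a local minimum of `r`, hence a critical point, against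
regularity. -/
theorem IsSmoothDefiningFunction.mem_frontier (hr : IsSmoothDefiningFunction r U) {q : ℂ × ℂ}
    (hq : r q = 0) : q ∈ frontier U := by
  refine ⟨?_, fun h => ?_⟩
  · by_contra hcl
    refine hr.fderiv_ne_zero q hq (IsLocalMin.fderiv_eq_zero ?_)
    filter_upwards [isClosed_closure.isOpen_compl.mem_nhds hcl] with x hx
    rw [hq]
    by_contra! hneg
    exact hx (subset_closure (by rw [hr.eq_neg]; exact hneg))
  · have := interior_subset h
    rw [hr.eq_neg] at this
    exact absurd hq (ne_of_lt this)

theorem exists_apply_eq_one {f : ℂ × ℂ →L[ℝ] ℝ} (hf : f ≠ 0) : ∃ v, f v = 1 := by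
  obtain ⟨v, hv⟩ := DFunLike.ne_iff.1 hf
  refine ⟨(f v)⁻¹ • v, ?_⟩
  rw [map_smul, smul_eq_mul]
  exact inv_mul_cancel₀ hv

/-- Near a regular zero of `r`, the distance to the zero set is controlled by `|r|`. -/
theorem exists_zero_near {q₀ : ℂ × ℂ} (hr : ContDiff ℝ ∞ r) (h0 : r q₀ = 0)
    (hd : fderiv ℝ r q₀ ≠ 0) :
    ∃ K : ℝ, 0 ≤ K ∧ ∀ᶠ p in 𝓝 q₀, r p < 0 → ∃ q, r q = 0 ∧ ‖q - p‖ ≤ K * |r p| := by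
  obtain ⟨v, hv⟩ := exists_apply_eq_one hd
  refine ⟨2 * ‖v‖, by positivity, ?_⟩
  have hstrict : HasStrictFDerivAt r (fderiv ℝ r q₀) q₀ :=
    (hr.contDiffAt.hasStrictFDerivAt (by simp))
  -- Moving by `2 |r p| v` raises `r` by `2 |r p|` to first order; this tolerance keeps the error
  -- below `|r p|`, so `r` changes sign along the way.
  have hc : 0 < 1 / (2 * (‖v‖ + 1)) := by positivity
  have hlo := hstrict.isLittleO.def hc
  have ht : Tendsto (fun p => (p + (2 * |r p|) • v, p)) (𝓝 q₀) (𝓝 (q₀, q₀)) := by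
    have : Continuous (fun p => (p + (2 * |r p|) • v, p)) := by
      have := hr.continuous
      fun_prop
    simpa [h0] using this.tendsto q₀
  filter_upwards [ht.eventually hlo] with p hp hneg
  simp only [add_sub_cancel_left, map_smul, hv, smul_eq_mul, mul_one, norm_smul, norm_mul,
    Real.norm_eq_abs, abs_abs, Nat.abs_ofNat] at hp
  have hbound : 1 / (2 * (‖v‖ + 1)) * (2 * |r p| * ‖v‖) ≤ |r p| := by
    rw [div_mul_eq_mul_div, div_le_iff₀ (by positivity)]
    nlinarith [norm_nonneg v, abs_nonneg (r p)]
  have hpos : 0 ≤ r (p + (2 * |r p|) • v) := by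
    have := (abs_le.1 (hp.trans hbound)).1
    have h' : |r p| = -r p := abs_of_neg hneg
    linarith
  have hT : (0 : ℝ) ≤ 2 * |r p| := by positivity
  have hcont : ContinuousOn (fun s : ℝ => r (p + s • v)) (Icc 0 (2 * |r p|)) := by
    have := hr.continuous
    fun_prop
  obtain ⟨s, hs, hs0⟩ := intermediate_value_Icc hT hcont
    (show (0 : ℝ) ∈ _ from ⟨by simpa using hneg.le, hpos⟩)
  refine ⟨_, hs0, ?_⟩
  rw [add_sub_cancel_left, norm_smul, Real.norm_eq_abs, abs_of_nonneg hs.1]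
  nlinarith [norm_nonneg v, hs.2]

theorem contDiff_fderiv_apply (hr : ContDiff ℝ ∞ r) (w : ℂ × ℂ) :
    ContDiff ℝ ∞ fun p => fderiv ℝ r p w :=
  (hr.fderiv_right (m := ∞) (by simp)).clm_apply contDiff_const

theorem contDiff_holoDeriv (hr : ContDiff ℝ ∞ r) (w : ℂ × ℂ) :
    ContDiff ℝ ∞ fun p => holoDeriv r p w :=
  (Complex.ofRealCLM.contDiff.comp (contDiff_fderiv_apply hr w)).sub
    (contDiff_const.mul (Complex.ofRealCLM.contDiff.comp (contDiff_fderiv_apply hr _)))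

theorem contDiff_fderiv_fderiv (hr : ContDiff ℝ ∞ r) :
    ContDiff ℝ ∞ (fderiv ℝ (fderiv ℝ r)) :=
  (hr.fderiv_right (m := ∞) (by simp)).fderiv_right (m := ∞) (by simp)

theorem contDiff_leviForm (hr : ContDiff ℝ ∞ r) (w : ℂ × ℂ) :
    ContDiff ℝ ∞ fun p => leviForm r p w := by
  have h := contDiff_fderiv_fderiv hr
  exact (((h.clm_apply contDiff_const).clm_apply contDiff_const).add
    ((h.clm_apply contDiff_const).clm_apply contDiff_const)).div_const 4

/-- On the boundary the Levi form in an arbitrary direction is bounded below in terms of the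
holomorphic derivative in that direction. -/
theorem leviForm_ge_of_boundary (hr : IsSmoothDefiningFunction r U)
    (hlevi : ∀ p ∈ frontier U, ∀ w, IsComplexTangent r p w → 0 ≤ leviForm r p w)
    {q₀ : ℂ × ℂ} (h0 : r q₀ = 0) (e : ℂ × ℂ) :
    ∃ K : ℝ, 0 ≤ K ∧ ∀ᶠ q in 𝓝 q₀, r q = 0 → -(K * ‖holoDeriv r q e‖) ≤ leviForm r q e := by
  obtain ⟨v, hv⟩ := exists_apply_eq_one (hr.fderiv_ne_zero q₀ h0)
  have hv1 : (1 / 2 : ℝ) < ‖holoDeriv r q₀ v‖ := by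
    have := Complex.abs_re_le_norm (holoDeriv r q₀ v)
    simp [holoDeriv, hv] at this ⊢
    linarith
  set B := ‖holoDeriv r q₀ e‖ + 1
  set M := ‖fderiv ℝ (fderiv ℝ r) q₀‖ + 1
  have hB : 0 < B := by positivity
  have hM : 0 < M := by positivity
  have hM' : ∀ᶠ q in 𝓝 q₀, ‖fderiv ℝ (fderiv ℝ r) q‖ < M :=
    ((continuous_norm (E := ℂ × ℂ →L[ℝ] ℂ × ℂ →L[ℝ] ℝ)).comp
      (contDiff_fderiv_fderiv hr.smooth).continuous).continuousAt.eventually_lt_const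
      (lt_add_one _)
  refine ⟨M * (2 * ‖v‖ * (2 * ‖e‖ + 2 * B * ‖v‖)), by positivity, ?_⟩
  filter_upwards [(contDiff_holoDeriv hr.smooth v).continuous.norm.continuousAt.eventually
      (lt_mem_nhds hv1),
    (contDiff_holoDeriv hr.smooth e).continuous.norm.continuousAt.eventually
      (gt_mem_nhds (show ‖holoDeriv r q₀ e‖ < B from lt_add_one _)),
    hM'] with q h1 h2 h3 hq
  have hne : holoDeriv r q v ≠ 0 := norm_pos_iff.1 (by linarith)
  -- Subtracting `c • v` makes `e` complex tangent; since `holoDeriv r q v` stays away from `0`, the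
  -- correction is of the size of `holoDeriv r q e`.
  set c := holoDeriv r q e / holoDeriv r q v
  have hc : ‖c‖ ≤ 2 * ‖holoDeriv r q e‖ := by
    rw [norm_div, div_le_iff₀ (by linarith)]
    nlinarith [norm_nonneg (holoDeriv r q e)]
  have hcv : ‖c • v‖ ≤ 2 * ‖holoDeriv r q e‖ * ‖v‖ := by
    rw [norm_smul]; exact mul_le_mul_of_nonneg_right hc (norm_nonneg _)
  have htan : IsComplexTangent r q (e - c • v) := by
    rw [isComplexTangent_iff, holoDeriv_sub_smul, div_mul_cancel₀ _ hne, sub_self]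
  have hL := hlevi q (hr.mem_frontier hq) _ htan
  have hdiff := abs_leviForm_sub_le r q e (e - c • v)
  rw [sub_sub_cancel] at hdiff
  have hw : ‖e‖ + ‖e - c • v‖ ≤ 2 * ‖e‖ + 2 * B * ‖v‖ := by
    have h4 := norm_sub_le e (c • v)
    have h5 : 2 * ‖holoDeriv r q e‖ * ‖v‖ ≤ 2 * B * ‖v‖ := by gcongr
    linarith
  have hrhs : ‖fderiv ℝ (fderiv ℝ r) q‖ * (‖c • v‖ * (‖e‖ + ‖e - c • v‖)) ≤
      M * ((2 * ‖holoDeriv r q e‖ * ‖v‖) * (2 * ‖e‖ + 2 * B * ‖v‖)) := by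
    gcongr
  have := (abs_le.1 (hdiff.trans hrhs)).1
  nlinarith

/-- The boundary estimate is carried inside to `p` from a zero `q` at distance `O(|r p|)`, the Levi
form and the holomorphic derivative being locally Lipschitz. -/
theorem eventually_leviForm_ge (hr : IsSmoothDefiningFunction r U)
    (hlevi : ∀ p ∈ frontier U, ∀ w, IsComplexTangent r p w → 0 ≤ leviForm r p w)
    {q₀ : ℂ × ℂ} (h0 : r q₀ = 0) (e : ℂ × ℂ) :
    ∃ K : ℝ, 0 ≤ K ∧ ∀ᶠ p in 𝓝 q₀, r p < 0 →
      -(K * (|r p| + ‖holoDeriv r p e‖)) ≤ leviForm r p e := by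
  obtain ⟨K₁, hK₁, hbd⟩ := leviForm_ge_of_boundary hr hlevi h0 e
  obtain ⟨K₂, hK₂, hnear⟩ := exists_zero_near hr.smooth h0 (hr.fderiv_ne_zero q₀ h0)
  obtain ⟨Λ₁, t₁, ht₁, hΛ₁⟩ := ((contDiff_holoDeriv hr.smooth e).contDiffAt (x := q₀)).of_le
    (m := 1) (by simp) |>.exists_lipschitzOnWith
  obtain ⟨Λ₂, t₂, ht₂, hΛ₂⟩ := ((contDiff_leviForm hr.smooth e).contDiffAt (x := q₀)).of_le
    (m := 1) (by simp) |>.exists_lipschitzOnWith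
  obtain ⟨δ, hδ, hball⟩ := Metric.mem_nhds_iff.1 (inter_mem hbd (inter_mem ht₁ ht₂))
  have hsmall : ∀ᶠ p in 𝓝 q₀, ‖p - q₀‖ + K₂ * |r p| < δ := by
    have hc : Continuous fun p => ‖p - q₀‖ + K₂ * |r p| := by
      have := hr.smooth.continuous
      fun_prop
    exact hc.continuousAt.eventually (gt_mem_nhds (by simpa [h0] using hδ))
  refine ⟨K₁ + K₁ * Λ₁ * K₂ + Λ₂ * K₂, by positivity, ?_⟩
  filter_upwards [hnear, hsmall] with p hp hsm hneg
  obtain ⟨q, hq0, hqp⟩ := hp hneg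
  have hp_mem := hball (show p ∈ Metric.ball q₀ δ by
    rw [Metric.mem_ball, dist_eq_norm]
    have : 0 ≤ K₂ * |r p| := by positivity
    linarith)
  have hq_mem := hball (show q ∈ Metric.ball q₀ δ by
    rw [Metric.mem_ball, dist_eq_norm]
    have := norm_sub_le_norm_sub_add_norm_sub q p q₀
    linarith)
  have h1 : -(K₁ * ‖holoDeriv r q e‖) ≤ leviForm r q e := hq_mem.1 hq0
  have h2 := hΛ₁.dist_le_mul q hq_mem.2.1 p hp_mem.2.1
  have h3 := hΛ₂.dist_le_mul q hq_mem.2.2 p hp_mem.2.2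
  rw [dist_eq_norm, dist_eq_norm] at h2 h3
  rw [Real.norm_eq_abs] at h3
  have h4 : ‖holoDeriv r q e‖ ≤ ‖holoDeriv r p e‖ + Λ₁ * (K₂ * |r p|) := by
    have := norm_le_norm_add_norm_sub' (holoDeriv r q e) (holoDeriv r p e)
    have : (Λ₁ : ℝ) * ‖q - p‖ ≤ Λ₁ * (K₂ * |r p|) := by gcongr
    linarith
  have h5 : leviForm r q e - leviForm r p e ≤ Λ₂ * (K₂ * |r p|) := by
    have : (Λ₂ : ℝ) * ‖q - p‖ ≤ Λ₂ * (K₂ * |r p|) := by gcongr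
    linarith [le_abs_self (leviForm r q e - leviForm r p e)]
  have h6 := mul_le_mul_of_nonneg_left h4 hK₁
  have h7 : 0 ≤ K₁ * |r p| := by positivity
  have h8 : 0 ≤ (K₁ * Λ₁ * K₂ + Λ₂ * K₂) * ‖holoDeriv r p e‖ := by positivity
  nlinarith

/-- Compactness of the boundary makes the constant uniform; off a neighbourhood of the boundary, `r`
is bounded away from `0` on `U`, which supplies `ε`. -/
theorem exists_leviForm_ge (hr : IsSmoothDefiningFunction r U) (hb : Bornology.IsBounded U)
    (hlevi : ∀ p ∈ frontier U, ∀ w, IsComplexTangent r p w → 0 ≤ leviForm r p w) (e : ℂ × ℂ) :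
    ∃ K : ℝ, 0 ≤ K ∧ ∃ ε > 0, ∀ p ∈ U, -ε < r p →
      -(K * (|r p| + ‖holoDeriv r p e‖)) ≤ leviForm r p e := by
  have hcl : IsCompact (closure U) := hb.isCompact_closure
  have hcomp : IsCompact (closure U ∩ r ⁻¹' {0}) :=
    hcl.inter_right (isClosed_singleton.preimage hr.smooth.continuous)
  obtain ⟨K, hK, hev⟩ : ∃ K : ℝ, 0 ≤ K ∧ ∃ N, IsOpen N ∧ closure U ∩ r ⁻¹' {0} ⊆ N ∧
      ∀ p ∈ N, r p < 0 → -(K * (|r p| + ‖holoDeriv r p e‖)) ≤ leviForm r p e := by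
    refine hcomp.induction_on (p := fun s => ∃ K : ℝ, 0 ≤ K ∧ ∃ N, IsOpen N ∧ s ⊆ N ∧
      ∀ p ∈ N, r p < 0 → -(K * (|r p| + ‖holoDeriv r p e‖)) ≤ leviForm r p e) ?_ ?_ ?_ ?_
    · exact ⟨0, le_rfl, ∅, isOpen_empty, subset_rfl, by simp⟩
    · rintro s t hst ⟨K, hK, N, hN, htN, h⟩
      exact ⟨K, hK, N, hN, hst.trans htN, h⟩
    · rintro s t ⟨K, hK, N, hN, hsN, h⟩ ⟨K', hK', N', hN', htN', h'⟩
      refine ⟨max K K', le_max_of_le_left hK, N ∪ N', hN.union hN', union_subset_union hsN htN', ?_⟩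
      rintro p (hp | hp) hneg
      · refine le_trans (neg_le_neg ?_) (h p hp hneg)
        gcongr; exact le_max_left _ _
      · refine le_trans (neg_le_neg ?_) (h' p hp hneg)
        gcongr; exact le_max_right _ _
    · rintro q ⟨-, hq⟩
      obtain ⟨K, hK, h⟩ := eventually_leviForm_ge hr hlevi hq e
      obtain ⟨N, hN, hNo, hqN⟩ := mem_nhds_iff.1 h
      exact ⟨N, mem_nhdsWithin_of_mem_nhds (hNo.mem_nhds hqN), K, hK, N, hNo, subset_rfl,
        fun p hp => hN hp⟩
  obtain ⟨N, hN, hsub, hbound⟩ := hev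
  refine ⟨K, hK, ?_⟩
  rcases (closure U \ N).eq_empty_or_nonempty with hemp | hne
  · refine ⟨1, one_pos, fun p hp _ => hbound p ?_ (by rw [hr.eq_neg] at hp; exact hp)⟩
    by_contra hpN
    exact (hemp ▸ (⟨subset_closure hp, hpN⟩ : p ∈ closure U \ N) : p ∈ (∅ : Set (ℂ × ℂ)))
  · obtain ⟨m, ⟨hm, hmN⟩, hmax⟩ :=
      (hcl.diff hN).exists_isMaxOn hne hr.smooth.continuous.continuousOn
    have hle : closure U ⊆ {z | r z ≤ 0} := by
      refine closure_minimal ?_ (isClosed_le hr.smooth.continuous continuous_const)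
      intro z hz
      rw [hr.eq_neg] at hz
      exact le_of_lt (show r z < 0 from hz)
    have hneg : r m < 0 := lt_of_le_of_ne (hle hm) fun h => hmN (hsub ⟨hm, h⟩)
    refine ⟨-r m, by linarith, fun p hp hpm => hbound p ?_ (by rw [hr.eq_neg] at hp; exact hp)⟩
    by_contra hpN
    have := hmax (show p ∈ closure U \ N from ⟨subset_closure hp, hpN⟩)
    have : r p ≤ r m := this
    linarith

/-! ### Vertical maxima of the weighted defining function -/

/-- Optimality conditions, along a real line in a vertical direction `c` with `|c| = 1`, at a local
maximum of `b ↦ r(a, b) exp(-C|b|²)`. -/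
theorem conditions_of_isLocalMax (hr : ContDiff ℝ ∞ r) {C : ℝ} {a b : ℂ}
    (hmax : IsLocalMax (fun b => r (a, b) * Real.exp (-(C * ‖b‖ ^ 2))) b) {c : ℂ} (hc : ‖c‖ = 1) :
    fderiv ℝ r (a, b) (0, c) = 2 * C * (inner ℝ b c) * r (a, b) ∧
      fderiv ℝ (fderiv ℝ r) (a, b) (0, c) (0, c) ≤
        r (a, b) * (2 * C + 4 * C ^ 2 * (inner ℝ b c) ^ 2) := by
  have hline : ∀ s : ℝ, HasDerivAt (fun s : ℝ => (a, b) + s • ((0 : ℂ), c)) ((0 : ℂ), c) s :=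
    fun s => by simpa using ((hasDerivAt_id s).smul_const ((0 : ℂ), c)).const_add (a, b)
  have h1 : ∀ s : ℝ, HasDerivAt (fun s : ℝ => r ((a, b) + s • ((0 : ℂ), c)))
      (fderiv ℝ r ((a, b) + s • ((0 : ℂ), c)) (0, c)) s := fun s =>
    ((hr.differentiable (by simp)) _).hasFDerivAt.comp_hasDerivAt s (hline s)
  have hdd : Differentiable ℝ (fderiv ℝ r) :=
    (hr.fderiv_right (m := ∞) (by simp)).differentiable (by simp)
  have h2 : HasDerivAt (fun s : ℝ => fderiv ℝ r ((a, b) + s • ((0 : ℂ), c)) (0, c))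
      (fderiv ℝ (fderiv ℝ r) ((a, b) + (0 : ℝ) • ((0 : ℂ), c)) (0, c) (0, c)) 0 := by
    have h := (hdd ((a, b) + (0 : ℝ) • ((0 : ℂ), c))).hasFDerivAt.comp_hasDerivAt (0 : ℝ) (hline 0)
    simpa using h.clm_apply (hasDerivAt_const (0 : ℝ) ((0 : ℂ), c))
  have hmax' : IsLocalMax (fun s : ℝ => r ((a, b) + s • ((0 : ℂ), c)) *
      Real.exp (-(C * (2 * inner ℝ b c * s + s ^ 2)))) 0 := by
    have ht : Tendsto (fun s : ℝ => b + s • c) (𝓝 0) (𝓝 b) := by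
      have : Continuous fun s : ℝ => b + s • c := by fun_prop
      simpa using this.tendsto 0
    filter_upwards [ht.eventually hmax] with s hs
    have hn : ‖b + s • c‖ ^ 2 = ‖b‖ ^ 2 + (2 * inner ℝ b c * s + s ^ 2) := by
      rw [norm_add_sq_real, inner_smul_right, norm_smul, hc, mul_one, Real.norm_eq_abs, sq_abs]
      ring
    rw [hn, mul_add, neg_add, Real.exp_add] at hs
    have hpos := Real.exp_pos (-(C * ‖b‖ ^ 2))
    simp only [zero_smul, add_zero, mul_zero, ne_eq, OfNat.ofNat_ne_zero, not_false_eq_true,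
      zero_pow, neg_zero, Real.exp_zero, mul_one, Prod.mk_add_mk, Prod.smul_mk, smul_zero]
    nlinarith
  simpa using hmax'.mul_gaussian h1 h2

/-- Combine the conditions in the directions `1` and `i`. As `r < 0` is the case of interest, the
upper bound is negative of order `C² |b|² |r|`, while the holomorphic derivative is only of order `C
|b| |r|`. -/
theorem leviForm_le_of_isLocalMax (hr : ContDiff ℝ ∞ r) {C : ℝ} {a b : ℂ}
    (hmax : IsLocalMax (fun b => r (a, b) * Real.exp (-(C * ‖b‖ ^ 2))) b) :
    ‖holoDeriv r (a, b) (0, 1)‖ = 2 * |C| * ‖b‖ * |r (a, b)| ∧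
      leviForm r (a, b) (0, 1) ≤ r (a, b) * (C + C ^ 2 * ‖b‖ ^ 2) := by
  obtain ⟨h1, h2⟩ := conditions_of_isLocalMax hr hmax (c := 1) (by simp)
  obtain ⟨h3, h4⟩ := conditions_of_isLocalMax hr hmax (c := Complex.I) (by simp)
  have e1 : inner ℝ b (1 : ℂ) = b.re := by simp [Complex.inner]
  have e2 : inner ℝ b Complex.I = b.im := by simp [Complex.inner]
  have hI : Complex.I • ((0 : ℂ), (1 : ℂ)) = (0, Complex.I) := by simp
  have hn : ‖b‖ ^ 2 = b.re ^ 2 + b.im ^ 2 := by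
    rw [Complex.sq_norm, Complex.normSq_apply]; ring
  rw [e1] at h1 h2
  rw [e2] at h3 h4
  constructor
  · have : holoDeriv r (a, b) (0, 1) = ((2 * C * r (a, b) : ℝ) : ℂ) * (starRingEnd ℂ) b := by
      rw [holoDeriv, hI, h1, h3]
      apply Complex.ext <;> simp <;> ring
    rw [this, norm_mul, Complex.norm_real, RCLike.norm_conj, Real.norm_eq_abs, abs_mul, abs_mul,
      abs_two]
    ring
  · rw [leviForm, hI, hn]
    nlinarith

end DefiningFunction

/-! ### Hulls in smoothly bounded domains, and conclusion -/

theorem IsSmoothlyBoundedPseudoconvexDomain.hasVerticalHulls {U : Set (ℂ × ℂ)}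
    (hU : IsSmoothlyBoundedPseudoconvexDomain U) {A : Set ℂ} (hA : IsCompact A) :
    HasVerticalHulls U A := by
  obtain ⟨-, hb, r, hr, hlevi⟩ := hU
  obtain ⟨K, hK, ε, hε, hbound⟩ := exists_leviForm_ge hr hb hlevi (0, 1)
  have hmem : ∀ z, z ∈ U ↔ r z < 0 := fun z => by rw [hr.eq_neg]; rfl
  -- This makes `C + C²x² - K(1 + 2Cx) = (Cx - K)² + C - K - K²` positive for every `x`.
  obtain ⟨C, hC0, hC⟩ : ∃ C : ℝ, 0 < C ∧ K + K ^ 2 < C := ⟨K + K ^ 2 + 1, by positivity, by linarith⟩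
  let g : ℂ × ℂ → ℝ := fun z => r z * Real.exp (-(C * ‖z.2‖ ^ 2))
  have hg : Continuous g := by
    have := hr.smooth.continuous
    fun_prop
  have hgneg : ∀ z, g z < 0 ↔ r z < 0 := fun z => ⟨fun h => by
    by_contra! h'
    exact absurd h (not_lt.2 (mul_nonneg h' (Real.exp_pos _).le)), fun h =>
    mul_neg_of_neg_of_pos h (Real.exp_pos _)⟩
  intro S hSU hS
  obtain ⟨m, hm, hSm⟩ : ∃ m < 0, ∀ z ∈ S, g z ≤ m := by
    rcases S.eq_empty_or_nonempty with rfl | hne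
    · exact ⟨-1, by norm_num, by simp⟩
    · obtain ⟨z, hz, hmax⟩ := hS.exists_isMaxOn hne hg.continuousOn
      exact ⟨g z, (hgneg z).2 ((hmem z).1 (hSU hz)), hmax⟩
  obtain ⟨R, hR⟩ := hA.isBounded.exists_norm_le
  -- A maximum over `A` is taken either on the frontier, where `m` bounds it, or at a point with `r
  -- ≤ -ε`, where the second term does; the remaining case contradicts the Levi bound.
  let M := max m (-ε * Real.exp (-(C * R ^ 2)))
  have hM : M < 0 := max_lt hm (by nlinarith [Real.exp_pos (-(C * R ^ 2))])
  have hsub : {z | g z ≤ M} ⊆ U := fun z hz => (hmem z).2 ((hgneg z).1 (lt_of_le_of_lt hz hM))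
  refine ⟨_, hsub, Metric.isCompact_of_isClosed_isBounded
    (isClosed_le hg continuous_const) (hb.subset hsub), fun a haU haS b hbA => ?_⟩
  obtain ⟨p, hpA, hp⟩ := hA.exists_isMaxOn ⟨b, hbA⟩
    (hg.comp (show Continuous fun b : ℂ => (a, b) by fun_prop)).continuousOn
  refine le_trans (show g (a, b) ≤ g (a, p) from hp hbA) ?_
  by_cases hpi : p ∈ interior A
  swap
  · exact (hSm _ (haS p ⟨subset_closure hpA, hpi⟩)).trans (le_max_left _ _)
  have hrp := (hmem _).1 (haU p hpA)
  by_cases hpε : -ε < r (a, p)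
  swap
  · refine le_trans ?_ (le_max_right _ _)
    have hexp : Real.exp (-(C * R ^ 2)) ≤ Real.exp (-(C * ‖p‖ ^ 2)) := by
      have := hR p hpA
      gcongr
    have := Real.exp_pos (-(C * R ^ 2))
    simp only [g]
    nlinarith
  exfalso
  have hloc : IsLocalMax (fun b => r (a, b) * Real.exp (-(C * ‖b‖ ^ 2))) p :=
    hp.isLocalMax (mem_interior_iff_mem_nhds.1 hpi)
  obtain ⟨h1, h2⟩ := leviForm_le_of_isLocalMax hr.smooth hloc
  have h3 := (hbound (a, p) (haU p hpA) hpε).trans h2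
  rw [h1, abs_of_neg hrp, abs_of_pos hC0] at h3
  have h4 : 0 < C + C ^ 2 * ‖p‖ ^ 2 - K * (1 + 2 * C * ‖p‖) := by
    nlinarith [sq_nonneg (C * ‖p‖ - K)]
  nlinarith [mul_pos (neg_pos.2 hrp) h4]

theorem filledHartogsFigure_subset_of_pseudoconvex {μ τ : ℝ} {η : ℝ → ℝ}
    (hη : IsWormProfile μ η) (hτ : τ ≤ μ) {U : Set (ℂ × ℂ)}
    (hU : IsPseudoconvex U ∨ IsSmoothlyBoundedPseudoconvexDomain U)
    (hWU : closure (wormDomain η) ⊆ U) : filledHartogsFigure τ ⊆ U := by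
  rcases hU with hU | hU
  · exact filledHartogsFigure_subset hη hτ hU.1 (hU.hasVerticalHulls (isCompact_logAnnulus τ)) hWU
  · exact filledHartogsFigure_subset hη hτ (hU.isOpen)
      (hU.hasVerticalHulls (isCompact_logAnnulus τ)) hWU

theorem mainTheorem9 (μ : ℝ) (hμ : Real.pi / 2 < μ) (η : ℝ → ℝ) (hη : IsWormProfile μ η) :
    HasNontrivialNebenhulle (wormDomain η) ∧
    (∃ V : Set (ℂ × ℂ), IsOpen V ∧ closure (wormDomain η) ⊆ V ∧
      ¬ ∃ U : Set (ℂ × ℂ), (IsPseudoconvex U ∨ IsSmoothlyBoundedPseudoconvexDomain U) ∧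
        closure (wormDomain η) ⊆ U ∧ U ⊆ V) ∧
    (∀ τ : ℝ, Real.pi / 2 < τ → τ ≤ μ → τ ≤ Real.pi →
      ¬ filledHartogsFigure τ ⊆ closure (wormDomain η) ∧
      ∀ U : Set (ℂ × ℂ), IsPseudoconvex U ∨ IsSmoothlyBoundedPseudoconvexDomain U →
        closure (wormDomain η) ⊆ U → filledHartogsFigure τ ⊆ U) := by
  have hout : ∀ τ : ℝ, Real.pi / 2 < τ → τ ≤ Real.pi →
      (((2 * Real.cos τ : ℝ) : ℂ), (1 : ℂ)) ∈ filledHartogsFigure τ ∧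
      (((2 * Real.cos τ : ℝ) : ℂ), (1 : ℂ)) ∉ closure (wormDomain η) := fun τ h1 h2 =>
    ⟨two_cos_mem_filledHartogsFigure (by linarith [Real.pi_pos]),
      two_cos_notMem_closure_wormDomain hη h1 h2⟩
  have hmin : Real.pi / 2 < min μ Real.pi := lt_min hμ (by linarith [Real.pi_pos])
  obtain ⟨hin, hnot⟩ := hout _ hmin (min_le_right _ _)
  -- For `V` it suffices to remove one point of the figure of height `min μ π` that lies off the
  -- closed worm; the same point refutes a Stein basis.
  refine ⟨?_, ⟨{(((2 * Real.cos (min μ Real.pi) : ℝ) : ℂ), 1)}ᶜ, isOpen_compl_singleton,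
    fun z hz h => hnot ?_, ?_⟩, fun τ h1 h2 h3 =>
    ⟨fun hsub => (hout τ h1 h3).2 (hsub (hout τ h1 h3).1), fun U hU hWU =>
      filledHartogsFigure_subset_of_pseudoconvex hη h2 hU hWU⟩⟩
  · rintro ⟨W, hW, -, hsub, hinter⟩
    refine hnot (hinter ▸ mem_iInter.2 fun j => ?_)
    exact filledHartogsFigure_subset_of_pseudoconvex hη (min_le_left _ _) (Or.inr (hW j)) (hsub j)
      hin
  · exact (mem_singleton_iff.1 h) ▸ hz
  · rintro ⟨U, hU, hWU, hUV⟩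
    exact hUV (filledHartogsFigure_subset_of_pseudoconvex hη (min_le_left _ _) hU hWU hin) rfl
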